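/- Let $\Gamma$ be the full Fock space over $\mathbb C^n$ with left creation operators $S_1,\dots,S_n$. For a Hilbert space $\mathcal E$, identify $\mathcal E$ with $e_\emptyset\otimes\mathcal E\subseteq\Gamma\otimes\mathcal E$, where $e_\emptyset$ is the vacuum vector. A bounded operator $M:\Gamma\otimes\mathcal E\to\Gamma\otimes\mathcal F$ is *multi-analytic* if $M(S_j\otimes I)=(S_j\otimes I)M$ for all $j$. If $\|M\|\le 1$, put $\Delta_M=(I-M^*M)^{1/2}$. $M$ is *purely contractive* if $\|P_{\mathcal F}Mh\|<\|h\|$ for all $0\ne h\in\mathcal E$, and it satisfies the *Szegő condition* if $\overline{\Delta_M(\Gamma\otimes\mathcal E)}=\overline{\Delta_M((\Gamma\otimes\mathcal E)\ominus\mathcal E)}$. Let $M:\Gamma\otimes\mathcal E\to\Gamma\otimes\mathcal F$ be a contractive multi-analytic operator, let $\mathcal G_M=\{Mw\oplus\Delta_Mw: w\in\Gamma\otimes\mathcal E\}$, and let $\mathcal H(M)=[(\Gamma\otimes\mathcal F)\oplus\overline{\Delta_M(\Gamma\otimes\mathcal E)}]\ominus\mathcal G_M$. The *model row contraction* $T_M=[T_{M,1},\dots,T_{M,n}]$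 on $\mathcal H(M)$ is given by $T_{M,j}^*(f\oplus g)=(S_j^*\otimes I)f\oplus C_j^*g$, where $C_j$ is the isometry of $\overline{\Delta_M(\Gamma\otimes\mathcal E)}$ with $C_j\Delta_Mf=\Delta_M(S_j\otimes I)f$. For contractive multi-analytic operators $\Theta_i:\Gamma\otimes\mathcal E_i\to\Gamma\otimes\mathcal E_{i+1}$ ($i=1,\dots,k$), with product $\Theta=\Theta_k\cdots\Theta_1$ and $\Delta_i=\Delta_{\Theta_i}$, let $$Z_k:\overline{\Delta_\Theta(\Gamma\otimes\mathcal E_1)}\to\overline{\Delta_k(\Gamma\otimes\mathcal E_k)}\oplus\cdots\oplus\overline{\Delta_1(\Gamma\otimes\mathcal E_1)}$$ be the isometry with $Z_k\Delta_\Theta f=\Delta_k\Theta_{k-1}\cdots\Theta_1f\oplus\cdots\oplus\Delta_1f$. The factorization is *$k$-regular* if $Z_k$ is unitary. The subspaces associated with a $k$-regular factorization are, for $i=1,\dots,k-1$, $$\mathcal M_i=\Big\{\Theta_k\cdots\Theta_{i+1}f\oplus Z_k^*\big(\Delta_k\Theta_{k-1}\cdots\Theta_{i+1}f\oplus\cdots\oplus\Delta_{i+1}f\oplus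 g_i\oplus\cdots\oplus g_1\big): f\in\Gamma\otimes\mathcal E_{i+1},\ g_l\in\overline{\Delta_l(\Gamma\otimes\mathcal E_l)}\Big\}\ominus\mathcal G_\Theta .$$ **Proposition.** Let $\Theta=\Theta_k\cdots\Theta_1$ be a $k$-regular factorization into contractive multi-analytic operators $\Theta_i:\Gamma\otimes\mathcal E_i\to\Gamma\otimes\mathcal E_{i+1}$, where $\Theta$ is purely contractive and satisfies the Szegő condition, and let $\mathcal M_1,\dots,\mathcal M_{k-1}$ be the associated subspaces. Let $0=j_0<j_1<\cdots<j_r=k$, let $J_i=\{j_{i-1}+1,\dots,j_i\}$ and $\Theta_{J_i}=\Theta_{j_i}\cdots\Theta_{j_{i-1}+1}$ for $i=1,\dots,r$. Then the $\Theta_{J_i}$ are contractive multi-analytic operators, and $\Theta=\Theta_{J_r}\cdots\Theta_{J_1}$ is an $r$-regular factorization. Let $\mathcal M_{J_1},\dots,\mathcal M_{J_{r-1}}$ be the subspaces associated with it. Then $\mathcal M_1\subseteq\cdots\subseteq\mathcal M_{k-1}$ and $\mathcal M_{J_1}\subseteq\cdots\subseteq\mathcal M_{J_{r-1}}$ are chains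 of joint invariant (closed) subspaces of $T_\Theta$ on $\mathcal H(\Theta)$, and $$\mathcal M_{J_i}=\mathcal M_{j_i}\qquad\text{for all } i=1,\dots,r-1 .$$ -/

import Mathlib

noncomputable section

namespace FockModel

open ContinuousLinearMap

/-! ### Defect operators of contractions between Hilbert spaces -/

section Defect

variable {H K : Type*} [NormedAddCommGroup H] [InnerProductSpace ℂ H] [CompleteSpace H]
  [NormedAddCommGroup K] [InnerProductSpace ℂ K] [CompleteSpace K]

/-- The defect operator `Δ_A = (I - A* A)^{1/2}` (used for contractions `A`). -/
def defect (A : H →L[ℂ] K) : H →L[ℂ] H :=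
  CFC.sqrt (1 - A.adjoint ∘L A)

/-- The defect space: the closure of the range of `Δ_A`. -/
def defectSpace (A : H →L[ℂ] K) : Submodule ℂ H :=
  (LinearMap.range (defect A).toLinearMap).topologicalClosure

instance (A : H →L[ℂ] K) : CompleteSpace (defectSpace A) :=
  (Submodule.isClosed_topologicalClosure _).completeSpace_coe

/-- `Δ_A` as a map onto a dense part of the defect space. -/
def toDefect (A : H →L[ℂ] K) : H →L[ℂ] defectSpace A :=
  (defect A).codRestrict (defectSpace A)
    (fun x => Submodule.le_topologicalClosure _ (LinearMap.mem_range_self _ x))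

@[simp] lemma coe_toDefect (A : H →L[ℂ] K) (x : H) : (toDefect A x : H) = defect A x := rfl

lemma denseRange_toDefect (A : H →L[ℂ] K) : DenseRange (toDefect A).toLinearMap := by
  intro y
  rw [closure_subtype]
  have h : Subtype.val '' Set.range (toDefect A).toLinearMap =
      (LinearMap.range (defect A).toLinearMap : Set H) := by
    ext z
    constructor
    · rintro ⟨_, ⟨x, rfl⟩, rfl⟩
      exact ⟨x, rfl⟩
    · rintro ⟨x, rfl⟩
      exact ⟨toDefect A x, ⟨x, rfl⟩, rfl⟩
  rw [h]
  exact y.2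

lemma isSelfAdjoint_defect (A : H →L[ℂ] K) : IsSelfAdjoint (defect A) :=
  IsSelfAdjoint.of_nonneg (CFC.sqrt_nonneg _)

lemma defect_mul_self {A : H →L[ℂ] K} (hA : ‖A‖ ≤ 1) :
    defect A * defect A = 1 - A.adjoint ∘L A := by
  refine CFC.sqrt_mul_sqrt_self _ ?_
  rw [ContinuousLinearMap.nonneg_iff_isPositive]
  refine ⟨?_, fun x => ?_⟩
  · rw [← ContinuousLinearMap.isSelfAdjoint_iff_isSymmetric]
    refine IsSelfAdjoint.sub (IsSelfAdjoint.one _) ?_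
    rw [ContinuousLinearMap.isSelfAdjoint_iff', adjoint_comp, adjoint_adjoint]
  · have h1 : ‖A x‖ ≤ ‖x‖ := by
      simpa using A.le_of_opNorm_le hA x
    have h2 : ‖A x‖ ^ 2 ≤ ‖x‖ ^ 2 := by gcongr
    have h3 : RCLike.re (inner ℂ x x) = ‖x‖ ^ 2 := inner_self_eq_norm_sq (𝕜 := ℂ) x
    have h4 : RCLike.re (inner ℂ (A x) (A x)) = ‖A x‖ ^ 2 := inner_self_eq_norm_sq (𝕜 := ℂ) (A x)
    have h5 : reApplyInnerSelf (1 - A.adjoint ∘L A) x =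
        RCLike.re (inner ℂ x x) - RCLike.re (inner ℂ (A x) (A x)) := by
      have h6 : (1 - A.adjoint ∘L A) x = x - A.adjoint (A x) := rfl
      rw [reApplyInnerSelf, h6, inner_sub_left, adjoint_inner_left, map_sub]
    rw [h5, h3, h4]
    linarith

lemma norm_defect_sq {A : H →L[ℂ] K} (hA : ‖A‖ ≤ 1) (x : H) :
    ‖defect A x‖ ^ 2 = ‖x‖ ^ 2 - ‖A x‖ ^ 2 := by
  have h : inner ℂ (defect A x) (defect A x) = inner ℂ x x - inner ℂ (A x) (A x) := by
    have h1 : inner ℂ (defect A x) (defect A x) = inner ℂ ((defect A * defect A) x) x := by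
      change _ = inner ℂ (defect A (defect A x)) x
      rw [← adjoint_inner_left (defect A),
        (ContinuousLinearMap.isSelfAdjoint_iff'.1 (isSelfAdjoint_defect A))]
    have h2 : (1 - A.adjoint ∘L A) x = x - A.adjoint (A x) := rfl
    rw [h1, defect_mul_self hA, h2, inner_sub_left, adjoint_inner_left]
  have h2 := congrArg Complex.re h
  have h3 : ∀ {L : Type _} [NormedAddCommGroup L] [InnerProductSpace ℂ L] (z : L),
      (inner ℂ z z : ℂ).re = ‖z‖ ^ 2 := fun z => inner_self_eq_norm_sq (𝕜 := ℂ) z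
  rw [Complex.sub_re, h3, h3] at h2
  rw [h2]
  congr 1
  exact inner_self_eq_norm_sq (𝕜 := ℂ) (A x)

end Defect

/-! ### The full Fock space with coefficients -/

/-- The Hilbert space `Γ ⊗ E`, where `Γ` is the full Fock space over `ℂⁿ`, as the space of square
summable families of vectors of `E` indexed by the free monoid on `n` letters; the elementary
tensor `e_α ⊗ x` is the family with value `x` at the word `α` and `0` elsewhere. -/
abbrev Fock (n : ℕ) (E : Type*) [NormedAddCommGroup E] : Type _ :=
  lp (fun _ : FreeMonoid (Fin n) => E) 2

section Fock

section Shift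

variable {n : ℕ} {E : Type*} [NormedAddCommGroup E]

/-- The family obtained by prefixing all words with the letter `i`: its value at `i β` is `f β`,
and its value at a word that does not begin with `i` is `0`. -/
def shiftFun (i : Fin n) (f : FreeMonoid (Fin n) → E) : FreeMonoid (Fin n) → E :=
  Function.extend (fun β => FreeMonoid.of i * β) f 0

lemma of_mul_injective (i : Fin n) :
    Function.Injective (fun β : FreeMonoid (Fin n) => FreeMonoid.of i * β) :=
  fun _ _ h => mul_left_cancel h

@[simp] lemma shiftFun_of_mul (i : Fin n) (f : FreeMonoid (Fin n) → E) (β : FreeMonoid (Fin n)) :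
    shiftFun i f (FreeMonoid.of i * β) = f β :=
  (of_mul_injective i).extend_apply f 0 β

lemma shiftFun_of_notMem (i : Fin n) (f : FreeMonoid (Fin n) → E) {α : FreeMonoid (Fin n)}
    (h : α ∉ Set.range (fun β => FreeMonoid.of i * β)) : shiftFun i f α = 0 :=
  Function.extend_apply' _ _ _ (fun ⟨β, hβ⟩ => h ⟨β, hβ⟩)

lemma hasSum_shiftFun (i : Fin n) (f : Fock n E) :
    HasSum (fun α => ‖shiftFun i f α‖ ^ (2 : ENNReal).toReal) (‖f‖ ^ (2 : ENNReal).toReal) := by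
  refine ((of_mul_injective i).hasSum_iff ?_).1 ?_
  · intro α hα
    simp [shiftFun_of_notMem i f hα]
  · have h := lp.hasSum_norm (p := 2) (by norm_num) f
    refine h.congr_fun ?_
    intro β
    simp

end Shift

variable {n : ℕ} {E F G : Type*}
  [NormedAddCommGroup E] [InnerProductSpace ℂ E]
  [NormedAddCommGroup F] [InnerProductSpace ℂ F]
  [NormedAddCommGroup G] [InnerProductSpace ℂ G]

/-- The left creation operator `S_i ⊗ I_E`, an isometry of `Γ ⊗ E`: it sends `e_β ⊗ x` to
`e_{iβ} ⊗ x`. -/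
def creation (i : Fin n) : Fock n E →ₗᵢ[ℂ] Fock n E where
  toFun f := ⟨shiftFun i f, memℓp_gen (hasSum_shiftFun i f).summable⟩
  map_add' f g := by
    ext α
    by_cases h : α ∈ Set.range (fun β : FreeMonoid (Fin n) => FreeMonoid.of i * β)
    · obtain ⟨β, rfl⟩ := h
      change shiftFun i (⇑f + ⇑g) _ = shiftFun i f _ + shiftFun i g _
      simp
    · change shiftFun i (⇑f + ⇑g) _ = shiftFun i f _ + shiftFun i g _
      simp [shiftFun_of_notMem i _ h]
  map_smul' c f := by
    ext α
    by_cases h : α ∈ Set.range (fun β : FreeMonoid (Fin n) => FreeMonoid.of i * β)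
    · obtain ⟨β, rfl⟩ := h
      simp
    · simp [shiftFun_of_notMem i _ h]
  norm_map' f := by
    have h1 := lp.hasSum_norm (p := 2) (by norm_num)
      (⟨shiftFun i f, memℓp_gen (hasSum_shiftFun i f).summable⟩ : Fock n E)
    have h2 := h1.unique (hasSum_shiftFun i f)
    simp only [ENNReal.toReal_ofNat, Real.rpow_ofNat] at h2
    exact (sq_eq_sq₀ (norm_nonneg _) (norm_nonneg _)).1 h2

/-- A bounded operator `Γ ⊗ E → Γ ⊗ F` is multi-analytic if it intertwines the left creation
operators. -/
def IsMultiAnalytic (M : Fock n E →L[ℂ] Fock n F) : Prop :=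
  ∀ (i : Fin n) (f : Fock n E), M (creation i f) = creation i (M f)

/-- Contractive multi-analytic operators. -/
structure IsContractiveMultiAnalytic (M : Fock n E →L[ℂ] Fock n F) : Prop where
  contraction : ‖M‖ ≤ 1
  multiAnalytic : IsMultiAnalytic M

lemma IsContractiveMultiAnalytic.id :
    IsContractiveMultiAnalytic (ContinuousLinearMap.id ℂ (Fock n E)) :=
  ⟨ContinuousLinearMap.norm_id_le, fun _ _ => rfl⟩

lemma IsContractiveMultiAnalytic.comp {M : Fock n F →L[ℂ] Fock n G} {N : Fock n E →L[ℂ] Fock n F}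
    (hM : IsContractiveMultiAnalytic M) (hN : IsContractiveMultiAnalytic N) :
    IsContractiveMultiAnalytic (M ∘L N) := by
  refine ⟨?_, fun i f => ?_⟩
  · calc ‖M ∘L N‖ ≤ ‖M‖ * ‖N‖ := ContinuousLinearMap.opNorm_comp_le _ _
      _ ≤ 1 * 1 := by gcongr <;> first | exact hM.contraction | exact hN.contraction
      _ = 1 := one_mul 1
  · simp only [coe_comp, Function.comp_apply]
    rw [hN.multiAnalytic, hM.multiAnalytic]

open scoped Classical in
/-- The embedding `h ↦ e_∅ ⊗ h` of `E` in `Γ ⊗ E`. -/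
def vacuumEmbedding (n : ℕ) (E : Type*) [NormedAddCommGroup E] [InnerProductSpace ℂ E] :
    E →ₗ[ℂ] Fock n E :=
  lp.lsingle (𝕜 := ℂ) (E := fun _ : FreeMonoid (Fin n) => E) 2 (1 : FreeMonoid (Fin n))

/-- `M` is purely contractive: `‖P (M (e_∅ ⊗ h))‖ < ‖h‖` for all `h ≠ 0`, where `P` is the
orthogonal projection onto `e_∅ ⊗ F`. The norm of `P y` is that of the coefficient of `y` at the
empty word. -/
def IsPurelyContractive (M : Fock n E →L[ℂ] Fock n F) : Prop :=
  ∀ h : E, h ≠ 0 → ‖M (vacuumEmbedding n E h) 1‖ < ‖h‖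

variable [CompleteSpace E] [CompleteSpace F]

/-- The Szegő condition: `Δ_M (Γ ⊗ E)` and `Δ_M ((Γ ⊗ E) ⊖ E)` have the same closure. -/
def SatisfiesSzego (M : Fock n E →L[ℂ] Fock n F) : Prop :=
  defectSpace M = ((LinearMap.range (vacuumEmbedding n E))ᗮ.map (defect M).toLinearMap).topologicalClosure

/-! ### The functional model of a contractive multi-analytic operator -/

/-- The row isometry `C = [C_1, …, C_n]` on the defect space of `M`: the continuous extension of
`Δ_M f ↦ Δ_M (S_j ⊗ I) f`. -/
def rowIsometry (M : Fock n E →L[ℂ] Fock n F) (j : Fin n) : defectSpace M →L[ℂ] defectSpace M :=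
  LinearMap.extendOfNorm
    (toDefect M ∘L (creation j).toContinuousLinearMap).toLinearMap (toDefect M).toLinearMap

lemma norm_toDefect_creation {M : Fock n E →L[ℂ] Fock n F} (hM : IsContractiveMultiAnalytic M)
    (j : Fin n) (f : Fock n E) : ‖toDefect M (creation j f)‖ = ‖toDefect M f‖ := by
  rw [← sq_eq_sq₀ (norm_nonneg _) (norm_nonneg _)]
  change ‖defect M (creation j f)‖ ^ 2 = ‖defect M f‖ ^ 2
  rw [norm_defect_sq hM.contraction, norm_defect_sq hM.contraction, hM.multiAnalytic,
    (creation j).norm_map, (creation j).norm_map]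

lemma rowIsometry_toDefect {M : Fock n E →L[ℂ] Fock n F} (hM : IsContractiveMultiAnalytic M)
    (j : Fin n) (f : Fock n E) :
    rowIsometry M j (toDefect M f) = toDefect M (creation j f) :=
  LinearMap.extendOfNorm_eq (denseRange_toDefect M)
    ⟨1, fun x => by simpa using (norm_toDefect_creation hM j x).le⟩ f

/-- The space `(Γ ⊗ F) ⊕ (Γ ⊗ E)`, which contains the model space of an operator
`Γ ⊗ E → Γ ⊗ F`. -/
abbrev Ambient (n : ℕ) (E F : Type*) [NormedAddCommGroup E] [NormedAddCommGroup F] : Type _ :=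
  WithLp 2 (Fock n F × Fock n E)

/-- The subspace `G_M = {M w ⊕ Δ_M w}`. -/
def graphSpace (M : Fock n E →L[ℂ] Fock n F) : Submodule ℂ (Ambient n E F) where
  carrier := {x | ∃ w : Fock n E, x = WithLp.toLp 2 (M w, defect M w)}
  zero_mem' := ⟨0, by simp only [map_zero]; rfl⟩
  add_mem' := by
    rintro _ _ ⟨v, rfl⟩ ⟨w, rfl⟩
    exact ⟨v + w, by simp [← WithLp.toLp_add]⟩
  smul_mem' := by
    rintro c _ ⟨v, rfl⟩
    exact ⟨c • v, by simp [← WithLp.toLp_smul]⟩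

/-- The model space `H(M) = [(Γ ⊗ F) ⊕ closure (Δ_M (Γ ⊗ E))] ⊖ G_M`. -/
def modelSpace (M : Fock n E →L[ℂ] Fock n F) : Submodule ℂ (Ambient n E F) :=
  (defectSpace M).comap (WithLp.sndL 2 ℂ (Fock n F) (Fock n E)).toLinearMap ⊓ (graphSpace M)ᗮ

lemma isClosed_modelSpace (M : Fock n E →L[ℂ] Fock n F) :
    IsClosed (modelSpace M : Set (Ambient n E F)) := by
  refine IsClosed.inter ?_ (Submodule.isClosed_orthogonal _)
  exact (Submodule.isClosed_topologicalClosure _).preimage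
    (WithLp.sndL 2 ℂ (Fock n F) (Fock n E)).continuous

instance (M : Fock n E →L[ℂ] Fock n F) : CompleteSpace (modelSpace M) :=
  (isClosed_modelSpace M).completeSpace_coe

/-- The operator `f ⊕ g ↦ (S_j* ⊗ I) f ⊕ C_j* g` on `H(M)`, with values in the ambient space. -/
def modelAdjointAux (M : Fock n E →L[ℂ] Fock n F) (j : Fin n) :
    modelSpace M →L[ℂ] Ambient n E F :=
  (WithLp.prodContinuousLinearEquiv 2 ℂ (Fock n F) (Fock n E)).symm.toContinuousLinearMap ∘L
    ((((creation j).toContinuousLinearMap : Fock n F →L[ℂ] Fock n F).adjoint ∘L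
        WithLp.fstL 2 ℂ (Fock n F) (Fock n E) ∘L (modelSpace M).subtypeL).prod
      ((defectSpace M).subtypeL ∘L (rowIsometry M j).adjoint ∘L
        (WithLp.sndL 2 ℂ (Fock n F) (Fock n E) ∘L (modelSpace M).subtypeL).codRestrict
          (defectSpace M) (fun x => x.2.1)))

lemma modelAdjointAux_mem {M : Fock n E →L[ℂ] Fock n F} (hM : IsContractiveMultiAnalytic M)
    (j : Fin n) (x : modelSpace M) : modelAdjointAux M j x ∈ modelSpace M := by
  obtain ⟨x, hx⟩ := x
  refine ⟨((rowIsometry M j).adjoint (⟨x.snd, hx.1⟩ : defectSpace M)).2,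
    (Submodule.mem_orthogonal _ _).2 ?_⟩
  rintro _ ⟨w, rfl⟩
  have h := (Submodule.mem_orthogonal _ _).1 hx.2 _ ⟨creation j w, rfl⟩
  rw [WithLp.prod_inner_apply] at h ⊢
  change inner ℂ (M (creation j w)) x.fst +
    inner ℂ (toDefect M (creation j w)) (⟨x.snd, hx.1⟩ : defectSpace M) = 0 at h
  change inner ℂ (M w) (((creation j).toContinuousLinearMap : Fock n F →L[ℂ] Fock n F).adjoint
    x.fst) + inner ℂ (toDefect M w)
      ((rowIsometry M j).adjoint (⟨x.snd, hx.1⟩ : defectSpace M)) = 0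
  rw [adjoint_inner_right, adjoint_inner_right, rowIsometry_toDefect hM]
  rw [hM.multiAnalytic] at h
  exact h

/-- The adjoint `T_{M,j}*` of the model operator, acting on `H(M)` by
`f ⊕ g ↦ (S_j* ⊗ I) f ⊕ C_j* g`. -/
def modelAdjoint {M : Fock n E →L[ℂ] Fock n F} (hM : IsContractiveMultiAnalytic M) (j : Fin n) :
    modelSpace M →L[ℂ] modelSpace M :=
  (modelAdjointAux M j).codRestrict (modelSpace M) (modelAdjointAux_mem hM j)

/-- The `j`-th entry `T_{M,j}` of the model row contraction `T_M` on `H(M)`. -/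
def modelOperator {M : Fock n E →L[ℂ] Fock n F} (hM : IsContractiveMultiAnalytic M) (j : Fin n) :
    modelSpace M →L[ℂ] modelSpace M :=
  (modelAdjoint hM j).adjoint

/-- `L` is a joint invariant subspace of the model space: a closed subspace of `H(M)` that is
invariant under all `T_{M,j}`. -/
structure IsJointInvariant {M : Fock n E →L[ℂ] Fock n F} (hM : IsContractiveMultiAnalytic M)
    (L : Submodule ℂ (Ambient n E F)) : Prop where
  isClosed : IsClosed (L : Set (Ambient n E F))
  le_modelSpace : L ≤ modelSpace M
  invariant : ∀ (j : Fin n) (x : modelSpace M),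
    (x : Ambient n E F) ∈ L → (modelOperator hM j x : Ambient n E F) ∈ L

end Fock

/-! ### Factorizations -/

section Factorization

variable {n k : ℕ} {E : Fin (k + 1) → Type*} [∀ i, NormedAddCommGroup (E i)]
  [∀ i, InnerProductSpace ℂ (E i)]

/-- The product `Θ_b ⋯ Θ_{a+1}` of consecutive factors (indexed from `1` as on paper; in Lean, the
factor `Θ i` with `i : Fin k` acts from `Γ ⊗ E i` to `Γ ⊗ E (i + 1)`). It is the identity when
`a = b`. -/
def segment (Θ : ∀ i : Fin k, Fock n (E i.castSucc) →L[ℂ] Fock n (E i.succ))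
    (a b : Fin (k + 1)) (hab : a ≤ b) : Fock n (E a) →L[ℂ] Fock n (E b) :=
  Nat.leRec (n := a.1)
    (motive := fun m _ => ∀ hm : m < k + 1, Fock n (E a) →L[ℂ] Fock n (E ⟨m, hm⟩))
    (fun _ => ContinuousLinearMap.id ℂ _)
    (fun m _ ih hm => Θ ⟨m, Nat.lt_of_succ_lt_succ hm⟩ ∘L ih (Nat.lt_of_succ_lt hm))
    (m := b.1) hab b.2

lemma segment_self (Θ : ∀ i : Fin k, Fock n (E i.castSucc) →L[ℂ] Fock n (E i.succ))
    (a : Fin (k + 1)) : segment Θ a a le_rfl = ContinuousLinearMap.id ℂ _ := by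
  simp [segment]

lemma segment_succ (Θ : ∀ i : Fin k, Fock n (E i.castSucc) →L[ℂ] Fock n (E i.succ))
    (a : Fin (k + 1)) (b : Fin k) (hab : a ≤ b.castSucc) :
    segment Θ a b.succ (hab.trans b.castSucc_le_succ) = Θ b ∘L segment Θ a b.castSucc hab := by
  have h : a.1 ≤ b.1 := hab
  simp only [segment]
  exact congrFun (Nat.leRec_succ (n := a.1)
    (motive := fun m _ => ∀ hm : m < k + 1, Fock n (E a) →L[ℂ] Fock n (E ⟨m, hm⟩)) _ _ h) _

/-- The full product `Θ_k ⋯ Θ_1`. -/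
def product (Θ : ∀ i : Fin k, Fock n (E i.castSucc) →L[ℂ] Fock n (E i.succ)) :
    Fock n (E 0) →L[ℂ] Fock n (E (Fin.last k)) :=
  segment Θ 0 (Fin.last k) (Fin.zero_le _)

lemma isContractiveMultiAnalytic_segment
    {Θ : ∀ i : Fin k, Fock n (E i.castSucc) →L[ℂ] Fock n (E i.succ)}
    (hΘ : ∀ i, IsContractiveMultiAnalytic (Θ i)) (a b : Fin (k + 1)) (hab : a ≤ b) :
    IsContractiveMultiAnalytic (segment Θ a b hab) := by
  induction b using Fin.induction with
  | zero =>
    obtain rfl : a = 0 := le_antisymm hab (Fin.zero_le _)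
    rw [segment_self]
    exact .id
  | succ b ih =>
    rcases eq_or_lt_of_le hab with rfl | h
    · rw [segment_self]
      exact .id
    · have h' : a ≤ b.castSucc := Fin.le_castSucc_iff.2 h
      rw [segment_succ Θ a b h']
      exact (hΘ b).comp (ih h')

lemma isContractiveMultiAnalytic_product
    {Θ : ∀ i : Fin k, Fock n (E i.castSucc) →L[ℂ] Fock n (E i.succ)}
    (hΘ : ∀ i, IsContractiveMultiAnalytic (Θ i)) : IsContractiveMultiAnalytic (product Θ) :=
  isContractiveMultiAnalytic_segment hΘ _ _ _

/-- The factors `Θ_{J_i} = Θ_{j_i} ⋯ Θ_{j_{i-1}+1}` of the factorization that is obtained by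
grouping the factors along the cut points `j_0 ≤ j_1 ≤ ⋯ ≤ j_r`. -/
def aggregate {r : ℕ} (Θ : ∀ i : Fin k, Fock n (E i.castSucc) →L[ℂ] Fock n (E i.succ))
    (j : Fin (r + 1) → Fin (k + 1)) (hj : Monotone j) (i : Fin r) :
    Fock n (E (j i.castSucc)) →L[ℂ] Fock n (E (j i.succ)) :=
  segment Θ (j i.castSucc) (j i.succ) (hj i.castSucc_le_succ)

/-- The identification of `Γ ⊗ E a` with `Γ ⊗ E a'` for equal indices `a = a'`. -/
def fockCast {a a' : Fin (k + 1)} (h : a = a') : Fock n (E a) ≃ₗᵢ[ℂ] Fock n (E a') :=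
  match a', h with
  | _, rfl => LinearIsometryEquiv.refl ℂ _

/-- The identification of `(Γ ⊗ E b) ⊕ (Γ ⊗ E a)` with `(Γ ⊗ E b') ⊕ (Γ ⊗ E a')` for equal
indices `a = a'` and `b = b'`. -/
def ambientCast {a a' b b' : Fin (k + 1)} (ha : a = a') (hb : b = b') :
    Ambient n (E a) (E b) ≃ₗᵢ[ℂ] Ambient n (E a') (E b') :=
  match a', b', ha, hb with
  | _, _, rfl, rfl => LinearIsometryEquiv.refl ℂ _

variable [∀ i, CompleteSpace (E i)]

/-- The Hilbert space direct sum of the closures of the ranges of `Δ_k, …, Δ_1`. -/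
abbrev DefectSum (Θ : ∀ i : Fin k, Fock n (E i.castSucc) →L[ℂ] Fock n (E i.succ)) : Type _ :=
  PiLp 2 (fun l : Fin k => defectSpace (Θ l))

/-- The map `f ↦ Δ_k Θ_{k-1} ⋯ Θ_1 f ⊕ ⋯ ⊕ Δ_2 Θ_1 f ⊕ Δ_1 f`. -/
def defectColumn (Θ : ∀ i : Fin k, Fock n (E i.castSucc) →L[ℂ] Fock n (E i.succ)) :
    Fock n (E 0) →L[ℂ] DefectSum Θ :=
  (PiLp.continuousLinearEquiv 2 ℂ
      (fun l : Fin k => defectSpace (Θ l))).symm.toContinuousLinearMap ∘L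
    ContinuousLinearMap.pi
      (fun l => toDefect (Θ l) ∘L segment Θ 0 l.castSucc (Fin.zero_le _))

/-- The isometry `Z_k` associated with the factorization: the continuous extension of
`Δ_Θ f ↦ Δ_k Θ_{k-1} ⋯ Θ_1 f ⊕ ⋯ ⊕ Δ_1 f` to the closure of the range of `Δ_Θ`, where
`Θ = Θ_k ⋯ Θ_1`. -/
def regularityMap (Θ : ∀ i : Fin k, Fock n (E i.castSucc) →L[ℂ] Fock n (E i.succ)) :
    defectSpace (product Θ) →L[ℂ] DefectSum Θ :=
  LinearMap.extendOfNorm (defectColumn Θ).toLinearMap (toDefect (product Θ)).toLinearMap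

/-- The factorization `Θ = Θ_k ⋯ Θ_1` is `k`-regular: `Z_k` is unitary. -/
def IsRegularFactorization (Θ : ∀ i : Fin k, Fock n (E i.castSucc) →L[ℂ] Fock n (E i.succ)) : Prop :=
  Isometry (regularityMap Θ) ∧ Function.Surjective (regularityMap Θ)

/-- The subspace `M_i` associated with the factorization `Θ = Θ_k ⋯ Θ_1`: the vectors
`Θ_k ⋯ Θ_{i+1} f ⊕ Z_k* (Δ_k Θ_{k-1} ⋯ Θ_{i+1} f ⊕ ⋯ ⊕ Δ_{i+1} f ⊕ g_i ⊕ ⋯ ⊕ g_1)`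
that are orthogonal to `G_Θ`, where `f ∈ Γ ⊗ E_{i+1}` and where `g_l` is in the closure of the
range of `Δ_l`. Below, `v` is the argument of `Z_k*`; its components with index at most `i` are
unconstrained. -/
def invariantSubspace (Θ : ∀ i : Fin k, Fock n (E i.castSucc) →L[ℂ] Fock n (E i.succ))
    (i : Fin (k + 1)) : Submodule ℂ (Ambient n (E 0) (E (Fin.last k))) where
  carrier := {x | (∃ (f : Fock n (E i)) (v : DefectSum Θ),
      (∀ (l : Fin k) (hl : i ≤ l.castSucc),
        v l = toDefect (Θ l) (segment Θ i l.castSucc hl f)) ∧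
      x = WithLp.toLp 2 (segment Θ i (Fin.last k) (Fin.le_last i) f,
        ((regularityMap Θ).adjoint v : Fock n (E 0)))) ∧
    x ∈ (graphSpace (product Θ))ᗮ}
  zero_mem' := ⟨⟨0, 0, by simp, by simp only [map_zero]; rfl⟩, Submodule.zero_mem _⟩
  add_mem' := by
    rintro _ _ ⟨⟨f, v, hv, rfl⟩, hx⟩ ⟨⟨g, w, hw, rfl⟩, hy⟩
    refine ⟨⟨f + g, v + w, fun l hl => ?_, ?_⟩, Submodule.add_mem _ hx hy⟩
    · rw [PiLp.add_apply, hv l hl, hw l hl, map_add, map_add]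
    · simp [← WithLp.toLp_add]
  smul_mem' := by
    rintro c _ ⟨⟨f, v, hv, rfl⟩, hx⟩
    refine ⟨⟨c • f, c • v, fun l hl => ?_, ?_⟩, Submodule.smul_mem _ c hx⟩
    · rw [PiLp.smul_apply, hv l hl, map_smul, map_smul]
    · simp [← WithLp.toLp_smul]

/-- The subspaces `M_1 ⊆ ⋯ ⊆ M_{k-1}` of the factorization form a chain of joint invariant
subspaces of the model row contraction `T_Θ`, where `Θ = Θ_k ⋯ Θ_1`. -/
def IsInvariantChain {Θ : ∀ i : Fin k, Fock n (E i.castSucc) →L[ℂ] Fock n (E i.succ)}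
    (hΘ : ∀ i, IsContractiveMultiAnalytic (Θ i)) : Prop :=
  (∀ i : Fin (k + 1), 0 < i → i < Fin.last k →
    IsJointInvariant (isContractiveMultiAnalytic_product hΘ) (invariantSubspace Θ i)) ∧
  ∀ i i' : Fin (k + 1), 0 < i → i ≤ i' → i' < Fin.last k →
    invariantSubspace Θ i ≤ invariantSubspace Θ i'

end Factorization

end FockModel

end

open FockModel

/-!
For a factorization `P = B A` into two contractions, `Δ_P f ↦ Δ_B A f` extends to a contraction `W`
from the defect space of `P` to that of `B` (`defectLift`). Consider the vectors `p ⊕ d` of the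
model space of `P` for which `p ⊕ W d` lies in the graph space of `B`; they form a closed subspace
`factorSubspace P A B`. The isometries `S_j ⊕ C_j`, whose compressions to the model space are the
`T_{P,j}`, preserve the condition on `p ⊕ d`, and the graph space of `P`, which is what the
compression projects away, satisfies it too. Hence the subspace is joint invariant
(`isJointInvariant_factorSubspace`), and it grows when a factor is moved from `B` to `A`
(`factorSubspace_mono`).

For a regular factorization `Θ = Θ_k ⋯ Θ_1`, the subspace `M_i` is the one attached to the two
factors `Θ_k ⋯ Θ_{i+1}` and `Θ_i ⋯ Θ_1` (`invariantSubspace_eq_factorSubspace`): since `Z_k` is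
unitary, `Z_k* v` may be replaced by a vector `d` with `Z_k d = v`, and the conditions on the
components of `d` beyond `i` say that `W d = Δ f` for the defect operator `Δ` of
`Θ_k ⋯ Θ_{i+1}`, because the components in the defect spaces of the factors determine a vector of
the defect space of a product (`eq_zero_of_defectCoord_eq_zero`). So `M_i` does not see how the two
products are factored further. The products of consecutive `Θ_{J_i}` are products of consecutive
`Θ_i` (`segment_aggregate`), so the subspaces of the two factorizations agree.

The isometry of the grouped factorization is surjective
(`isRegularFactorization_aggregate`): given target vectors `u_m`, take the components of all of
them in the defect spaces of the single factors, choose `d` with `Z_k d` equal to this family, and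
use once more that components determine vectors.
-/

noncomputable section

namespace FockModel

open ContinuousLinearMap

/-! ### Maps out of defect spaces -/

lemma norm_apply_le_of_contraction {H K : Type*} [NormedAddCommGroup H] [InnerProductSpace ℂ H]
    [NormedAddCommGroup K] [InnerProductSpace ℂ K] {A : H →L[ℂ] K} (hA : ‖A‖ ≤ 1) (x : H) :
    ‖A x‖ ≤ ‖x‖ := by
  simpa using A.le_of_opNorm_le hA x

section DefectLift

variable {H K L V W : Type*} [NormedAddCommGroup H] [InnerProductSpace ℂ H] [CompleteSpace H]
  [NormedAddCommGroup K] [InnerProductSpace ℂ K] [CompleteSpace K]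
  [NormedAddCommGroup L] [InnerProductSpace ℂ L] [CompleteSpace L]
  [NormedAddCommGroup V] [InnerProductSpace ℂ V] [CompleteSpace V]
  [NormedAddCommGroup W] [InnerProductSpace ℂ W] [CompleteSpace W]

/-- The continuous extension of `Δ_A f ↦ X f` to the defect space of `A`. It is meaningful when
`‖X f‖ ≤ ‖Δ_A f‖` for all `f`. -/
def defectLift (A : H →L[ℂ] K) (X : H →L[ℂ] W) : defectSpace A →L[ℂ] W :=
  LinearMap.extendOfNorm X.toLinearMap (toDefect A).toLinearMap

lemma defectLift_toDefect {A : H →L[ℂ] K} {X : H →L[ℂ] W} (hX : ∀ f, ‖X f‖ ≤ ‖toDefect A f‖)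
    (f : H) : defectLift A X (toDefect A f) = X f :=
  LinearMap.extendOfNorm_eq (denseRange_toDefect A) ⟨1, fun x => by simpa using hX x⟩ f

lemma defectSpace_induction {A : H →L[ℂ] K} {p : defectSpace A → Prop}
    (hp : IsClosed {d | p d}) (h : ∀ f, p (toDefect A f)) (d : defectSpace A) : p d :=
  (denseRange_toDefect A).induction_on d hp h

lemma defectLift_defectLift {A : H →L[ℂ] K} {B : L →L[ℂ] V} {C : H →L[ℂ] L} {X : L →L[ℂ] W}
    (hC : ∀ f, ‖toDefect B (C f)‖ ≤ ‖toDefect A f‖) (hX : ∀ g, ‖X g‖ ≤ ‖toDefect B g‖)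
    (d : defectSpace A) :
    defectLift B X (defectLift A (toDefect B ∘L C) d) = defectLift A (X ∘L C) d := by
  induction d using defectSpace_induction with
  | hp => exact isClosed_eq (by fun_prop) (by fun_prop)
  | h f =>
    rw [defectLift_toDefect (X := toDefect B ∘L C) hC, coe_comp, Function.comp_apply,
      defectLift_toDefect hX, defectLift_toDefect (X := X ∘L C) fun g => (hX _).trans (hC g)]
    rfl

lemma norm_toDefect_sq {A : H →L[ℂ] K} (hA : ‖A‖ ≤ 1) (x : H) :
    ‖toDefect A x‖ ^ 2 = ‖x‖ ^ 2 - ‖A x‖ ^ 2 :=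
  norm_defect_sq hA x

/-- The defect of a middle factor, applied after the first factor, is dominated by the defect of
the whole product. -/
lemma norm_toDefect_middle_le {A : H →L[ℂ] L} {B : L →L[ℂ] V} {C : V →L[ℂ] K} {P : H →L[ℂ] K}
    (hA : ‖A‖ ≤ 1) (hB : ‖B‖ ≤ 1) (hC : ‖C‖ ≤ 1) (hP : ‖P‖ ≤ 1)
    (h : ∀ f, P f = C (B (A f))) (f : H) : ‖toDefect B (A f)‖ ≤ ‖toDefect P f‖ := by
  rw [← sq_le_sq₀ (norm_nonneg _) (norm_nonneg _), norm_toDefect_sq hB, norm_toDefect_sq hP, h]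
  have h1 := pow_le_pow_left₀ (norm_nonneg _) (norm_apply_le_of_contraction hA f) 2
  have h2 := pow_le_pow_left₀ (norm_nonneg _) (norm_apply_le_of_contraction hC (B (A f))) 2
  linarith

lemma norm_toDefect_left_le {A : H →L[ℂ] L} {B : L →L[ℂ] K} {P : H →L[ℂ] K}
    (hA : ‖A‖ ≤ 1) (hB : ‖B‖ ≤ 1) (hP : ‖P‖ ≤ 1) (h : ∀ f, P f = B (A f)) (f : H) :
    ‖toDefect B (A f)‖ ≤ ‖toDefect P f‖ :=
  norm_toDefect_middle_le hA hB (C := ContinuousLinearMap.id ℂ K) norm_id_le hP h f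

lemma norm_toDefect_right_le {A : H →L[ℂ] L} {B : L →L[ℂ] K} {P : H →L[ℂ] K}
    (hA : ‖A‖ ≤ 1) (hB : ‖B‖ ≤ 1) (hP : ‖P‖ ≤ 1) (h : ∀ f, P f = B (A f)) (f : H) :
    ‖toDefect A f‖ ≤ ‖toDefect P f‖ :=
  norm_toDefect_middle_le (A := ContinuousLinearMap.id ℂ H) norm_id_le hA hB hP h f

/-- For a product `P = B A`, the map `Δ_P f ↦ Δ_A f ⊕ Δ_B A f` is isometric. -/
lemma norm_defectLift_sq_add {A : H →L[ℂ] L} {B : L →L[ℂ] K} {P : H →L[ℂ] K}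
    (hA : ‖A‖ ≤ 1) (hB : ‖B‖ ≤ 1) (hP : ‖P‖ ≤ 1) (h : ∀ f, P f = B (A f))
    (d : defectSpace P) :
    ‖defectLift P (toDefect A) d‖ ^ 2 + ‖defectLift P (toDefect B ∘L A) d‖ ^ 2 = ‖d‖ ^ 2 := by
  induction d using defectSpace_induction with
  | hp => exact isClosed_eq (by fun_prop) (by fun_prop)
  | h f =>
    rw [defectLift_toDefect (X := toDefect A) (norm_toDefect_right_le hA hB hP h),
      defectLift_toDefect (X := toDefect B ∘L A) (norm_toDefect_left_le hA hB hP h),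
      coe_comp, Function.comp_apply, norm_toDefect_sq hA, norm_toDefect_sq hB,
      norm_toDefect_sq hP, h]
    ring

lemma eq_zero_of_defectLift_eq_zero {A : H →L[ℂ] L} {B : L →L[ℂ] K} {P : H →L[ℂ] K}
    (hA : ‖A‖ ≤ 1) (hB : ‖B‖ ≤ 1) (hP : ‖P‖ ≤ 1) (h : ∀ f, P f = B (A f))
    {d : defectSpace P} (h1 : defectLift P (toDefect A) d = 0)
    (h2 : defectLift P (toDefect B ∘L A) d = 0) : d = 0 := by
  have h3 := norm_defectLift_sq_add hA hB hP h d
  rw [h1, h2] at h3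
  simpa using h3.symm

lemma eq_zero_of_mem_defectSpace_id (d : defectSpace (ContinuousLinearMap.id ℂ H)) : d = 0 := by
  induction d using defectSpace_induction with
  | hp => exact isClosed_eq (by fun_prop) (by fun_prop)
  | h f =>
    have h1 := norm_toDefect_sq (A := ContinuousLinearMap.id ℂ H) norm_id_le f
    exact Subtype.ext (by simpa using h1)

end DefectLift

/-! ### Invariant subspaces of the model from a factorization into two factors -/

section FactorSubspace

variable {n : ℕ} {E F F' G : Type*}
  [NormedAddCommGroup E] [InnerProductSpace ℂ E] [CompleteSpace E]
  [NormedAddCommGroup F] [InnerProductSpace ℂ F] [CompleteSpace F]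
  [NormedAddCommGroup F'] [InnerProductSpace ℂ F'] [CompleteSpace F']
  [NormedAddCommGroup G] [InnerProductSpace ℂ G] [CompleteSpace G]

/-- The component in the defect space of a vector of the model space. -/
def modelDefect (P : Fock n E →L[ℂ] Fock n G) : modelSpace P →L[ℂ] defectSpace P :=
  (WithLp.sndL 2 ℂ (Fock n G) (Fock n E) ∘L (modelSpace P).subtypeL).codRestrict
    (defectSpace P) (fun x => x.2.1)

/-- The map `p ⊕ d ↦ p ⊕ W d` on the model space of `P`, where `W` extends `Δ_P f ↦ Δ_B A f`. -/
def factorMap (P : Fock n E →L[ℂ] Fock n G) (A : Fock n E →L[ℂ] Fock n F)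
    (B : Fock n F →L[ℂ] Fock n G) : modelSpace P →L[ℂ] Ambient n F G :=
  (WithLp.prodContinuousLinearEquiv 2 ℂ (Fock n G) (Fock n F)).symm.toContinuousLinearMap ∘L
    ((WithLp.fstL 2 ℂ (Fock n G) (Fock n E) ∘L (modelSpace P).subtypeL).prod
      ((defectSpace B).subtypeL ∘L defectLift P (toDefect B ∘L A) ∘L modelDefect P))

/-- The subspace of the model space of `P` that is attached to a factorization `P = B A` into two
factors: the vectors `p ⊕ d` for which `p ⊕ W d` is in the graph space of `B`, where `W` extends
`Δ_P f ↦ Δ_B A f`. The product `P` is a separate argument, so that no equality of operators has to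
be transported through the type. -/
def factorSubspace (P : Fock n E →L[ℂ] Fock n G) (A : Fock n E →L[ℂ] Fock n F)
    (B : Fock n F →L[ℂ] Fock n G) : Submodule ℂ (Ambient n E G) :=
  ((graphSpace B).comap (factorMap P A B).toLinearMap).map (modelSpace P).subtype

lemma mem_factorSubspace {P : Fock n E →L[ℂ] Fock n G} {A : Fock n E →L[ℂ] Fock n F}
    {B : Fock n F →L[ℂ] Fock n G} {x : Ambient n E G} :
    x ∈ factorSubspace P A B ↔ ∃ hx : x ∈ modelSpace P, ∃ w, x.fst = B w ∧
      defectLift P (toDefect B ∘L A) ⟨x.snd, hx.1⟩ = toDefect B w := by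
  constructor
  · rintro ⟨y, ⟨w, hw⟩, rfl⟩
    refine ⟨y.2, w, congrArg WithLp.fst hw, Subtype.ext (congrArg WithLp.snd hw)⟩
  · rintro ⟨hx, w, h1, h2⟩
    refine ⟨⟨x, hx⟩, ⟨w, ?_⟩, rfl⟩
    change WithLp.toLp 2 (x.fst, (defectLift P (toDefect B ∘L A) ⟨x.snd, hx.1⟩ : Fock n F)) = _
    rw [h1, h2]
    rfl

lemma isClosed_graphSpace {M : Fock n E →L[ℂ] Fock n F} (hM : ‖M‖ ≤ 1) :
    IsClosed (graphSpace M : Set (Ambient n E F)) := by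
  let g : Fock n E →ₗᵢ[ℂ] Ambient n E F :=
    { toFun := fun w => WithLp.toLp 2 (M w, defect M w)
      map_add' := fun v w => by simp [← WithLp.toLp_add]
      map_smul' := fun c w => by simp [← WithLp.toLp_smul]
      norm_map' := fun w => by
        rw [← sq_eq_sq₀ (norm_nonneg _) (norm_nonneg _)]
        change ‖WithLp.toLp 2 (M w, defect M w)‖ ^ 2 = _
        rw [WithLp.prod_norm_sq_eq_of_L2]
        simp [norm_defect_sq hM] }
  have h : (graphSpace M : Set (Ambient n E F)) = Set.range g := by
    ext x
    exact ⟨fun ⟨w, hw⟩ => ⟨w, hw.symm⟩, fun ⟨w, hw⟩ => ⟨w, hw.symm⟩⟩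
  rw [h]
  exact g.isometry.isClosedEmbedding.isClosed_range

lemma isClosed_factorSubspace {P : Fock n E →L[ℂ] Fock n G} {A : Fock n E →L[ℂ] Fock n F}
    {B : Fock n F →L[ℂ] Fock n G} (hB : ‖B‖ ≤ 1) :
    IsClosed (factorSubspace P A B : Set (Ambient n E G)) :=
  (isClosed_modelSpace P).isClosedEmbedding_subtypeVal.isClosedMap _
    ((isClosed_graphSpace hB).preimage (factorMap P A B).continuous)

/-- Inside `(Γ ⊗ F) ⊕ closure (Δ_M (Γ ⊗ E))`, the orthogonal complement of the model space is the
graph space. -/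
lemma mem_graphSpace_of_orthogonal {M : Fock n E →L[ℂ] Fock n F} (hM : ‖M‖ ≤ 1)
    {y : Ambient n E F} (hy : y.snd ∈ defectSpace M) (h : ∀ z ∈ modelSpace M, inner ℂ y z = 0) :
    y ∈ graphSpace M := by
  have : CompleteSpace (graphSpace M) := (isClosed_graphSpace hM).completeSpace_coe
  obtain ⟨u, hu, v, hv, rfl⟩ := (graphSpace M).exists_add_mem_mem_orthogonal y
  have hu' : u.snd ∈ defectSpace M := by
    obtain ⟨w, rfl⟩ := hu
    exact (toDefect M w).2
  have hv' : v ∈ modelSpace M := by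
    refine ⟨?_, hv⟩
    have := (defectSpace M).sub_mem hy hu'
    simpa using this
  have h1 := h v hv'
  rw [inner_add_left, (Submodule.mem_orthogonal _ _).1 hv u hu, zero_add] at h1
  rw [inner_self_eq_zero.1 h1, add_zero]
  exact hu

lemma defectLift_rowIsometry {P : Fock n E →L[ℂ] Fock n G} {A : Fock n E →L[ℂ] Fock n F}
    {B : Fock n F →L[ℂ] Fock n G} (hP : IsContractiveMultiAnalytic P)
    (hA : IsContractiveMultiAnalytic A) (hB : IsContractiveMultiAnalytic B)
    (h : ∀ f, P f = B (A f)) (j : Fin n) (d : defectSpace P) :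
    defectLift P (toDefect B ∘L A) (rowIsometry P j d) =
      rowIsometry B j (defectLift P (toDefect B ∘L A) d) := by
  have hn := norm_toDefect_left_le hA.contraction hB.contraction hP.contraction h
  induction d using defectSpace_induction with
  | hp => exact isClosed_eq (by fun_prop) (by fun_prop)
  | h f =>
    rw [rowIsometry_toDefect hP, defectLift_toDefect (X := toDefect B ∘L A) hn,
      defectLift_toDefect (X := toDefect B ∘L A) hn, coe_comp, Function.comp_apply,
      Function.comp_apply, rowIsometry_toDefect hB, hA.multiAnalytic]

/-- The operators `S_j ⊕ C_j` leave `{p ⊕ d : p ⊕ W d ∈ G_B}` invariant, and this space contains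
the graph space of `P`, so that compressing to the model space does not lead out of it. -/
lemma isJointInvariant_factorSubspace {P : Fock n E →L[ℂ] Fock n G}
    {A : Fock n E →L[ℂ] Fock n F} {B : Fock n F →L[ℂ] Fock n G}
    (hP : IsContractiveMultiAnalytic P) (hA : IsContractiveMultiAnalytic A)
    (hB : IsContractiveMultiAnalytic B) (h : ∀ f, P f = B (A f)) :
    IsJointInvariant hP (factorSubspace P A B) where
  isClosed := isClosed_factorSubspace hB.contraction
  le_modelSpace := fun x hx => (mem_factorSubspace.1 hx).1
  invariant := by
    intro j x hx
    obtain ⟨hxm, w, hw1, hw2⟩ := mem_factorSubspace.1 hx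
    set d : defectSpace P := ⟨(x : Ambient n E G).snd, hxm.1⟩
    set y : Ambient n E G :=
      WithLp.toLp 2 (creation j (x : Ambient n E G).fst, (rowIsometry P j d : Fock n E)) with hy
    set t := modelOperator hP j x
    -- `T_j x` is the compression of `(S_j ⊕ C_j) x`, so the two differ by a graph vector.
    have hdiff : y - t ∈ graphSpace P := by
      refine mem_graphSpace_of_orthogonal hP.contraction
        ((defectSpace P).sub_mem (rowIsometry P j d).2 t.2.1) fun z hz => ?_
      rw [inner_sub_left, sub_eq_zero]
      have h1 : inner ℂ (t : Ambient n E G) z = inner ℂ x (modelAdjoint hP j ⟨z, hz⟩) :=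
        adjoint_inner_left (modelAdjoint hP j) ⟨z, hz⟩ x
      rw [h1, Submodule.coe_inner, WithLp.prod_inner_apply, WithLp.prod_inner_apply]
      change _ = inner ℂ (x : Ambient n E G).fst
        (((creation j).toContinuousLinearMap : Fock n G →L[ℂ] Fock n G).adjoint z.fst) +
          inner ℂ d ((rowIsometry P j).adjoint (⟨z.snd, hz.1⟩ : defectSpace P))
      rw [adjoint_inner_right, adjoint_inner_right]
      rfl
    obtain ⟨u, hu⟩ := hdiff
    have ht : (t : Ambient n E G) = y - WithLp.toLp 2 (P u, defect P u) := by
      rw [← hu]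
      abel
    refine mem_factorSubspace.2 ⟨t.2, creation j w - A u, ?_, ?_⟩
    · rw [ht, map_sub, hB.multiAnalytic, ← hw1, ← h]
      rfl
    · have h2 : (⟨(t : Ambient n E G).snd, t.2.1⟩ : defectSpace P) =
          rowIsometry P j d - toDefect P u := Subtype.ext (congrArg WithLp.snd ht)
      rw [h2, map_sub, defectLift_rowIsometry hP hA hB h, hw2, rowIsometry_toDefect hB, map_sub,
        defectLift_toDefect (X := toDefect B ∘L A)
          (norm_toDefect_left_le hA.contraction hB.contraction hP.contraction h)]
      rfl

lemma factorSubspace_mono {P : Fock n E →L[ℂ] Fock n G} {A : Fock n E →L[ℂ] Fock n F}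
    {B : Fock n F →L[ℂ] Fock n G} {C : Fock n F →L[ℂ] Fock n F'} {A' : Fock n E →L[ℂ] Fock n F'}
    {B' : Fock n F' →L[ℂ] Fock n G}
    (hP : ‖P‖ ≤ 1) (hA : ‖A‖ ≤ 1) (hB : ‖B‖ ≤ 1) (hC : ‖C‖ ≤ 1) (hB' : ‖B'‖ ≤ 1)
    (h : ∀ f, P f = B (A f)) (hAC : A' = C ∘L A) (hBC : ∀ f, B f = B' (C f)) :
    factorSubspace P A B ≤ factorSubspace P A' B' := by
  intro x hx
  obtain ⟨hxm, w, hw1, hw2⟩ := mem_factorSubspace.1 hx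
  refine mem_factorSubspace.2 ⟨hxm, C w, by rw [hw1, hBC], ?_⟩
  have hn := norm_toDefect_left_le hC hB' hB hBC
  rw [hAC, ← comp_assoc, ← defectLift_defectLift (B := B) (X := toDefect B' ∘L C)
    (norm_toDefect_left_le hA hB hP h) hn, hw2, defectLift_toDefect (X := toDefect B' ∘L C) hn]
  rfl

end FactorSubspace
/-! ### Segments of a factorization -/

section Segment

variable {n k : ℕ} {E : Fin (k + 1) → Type*} [∀ i, NormedAddCommGroup (E i)]
  [∀ i, InnerProductSpace ℂ (E i)]

lemma segment_comp (Θ : ∀ i : Fin k, Fock n (E i.castSucc) →L[ℂ] Fock n (E i.succ))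
    (a b c : Fin (k + 1)) (hab : a ≤ b) (hbc : b ≤ c) :
    segment Θ a c (hab.trans hbc) = segment Θ b c hbc ∘L segment Θ a b hab := by
  induction c using Fin.induction with
  | zero =>
    obtain rfl : b = 0 := le_antisymm hbc (Fin.zero_le _)
    rw [segment_self]
    rfl
  | succ c ih =>
    rcases eq_or_lt_of_le hbc with rfl | h
    · rw [segment_self]
      rfl
    · have h' : b ≤ c.castSucc := Fin.le_castSucc_iff.2 h
      rw [segment_succ Θ b c h', segment_succ Θ a c (hab.trans h'), ih h', comp_assoc]

lemma segment_apply (Θ : ∀ i : Fin k, Fock n (E i.castSucc) →L[ℂ] Fock n (E i.succ))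
    (a b c : Fin (k + 1)) (hab : a ≤ b) (hbc : b ≤ c) (f : Fock n (E a)) :
    segment Θ a c (hab.trans hbc) f = segment Θ b c hbc (segment Θ a b hab f) := by
  rw [segment_comp Θ a b c hab hbc]
  rfl

lemma segment_aggregate {r : ℕ} (Θ : ∀ i : Fin k, Fock n (E i.castSucc) →L[ℂ] Fock n (E i.succ))
    (j : Fin (r + 1) → Fin (k + 1)) (hj : Monotone j) (a b : Fin (r + 1)) (hab : a ≤ b) :
    segment (E := fun i => E (j i)) (aggregate Θ j hj) a b hab =
      segment Θ (j a) (j b) (hj hab) := by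
  induction b using Fin.induction with
  | zero =>
    obtain rfl : a = 0 := le_antisymm hab (Fin.zero_le _)
    rw [segment_self, segment_self]
  | succ b ih =>
    rcases eq_or_lt_of_le hab with rfl | h
    · rw [segment_self, segment_self]
    · have h' : a ≤ b.castSucc := Fin.le_castSucc_iff.2 h
      rw [segment_succ (E := fun i => E (j i)) (aggregate Θ j hj) a b h', ih h',
        segment_comp Θ (j a) (j b.castSucc) (j b.succ) (hj h') (hj b.castSucc_le_succ)]
      rfl

lemma fockCast_segment (Θ : ∀ i : Fin k, Fock n (E i.castSucc) →L[ℂ] Fock n (E i.succ))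
    {a b : Fin (k + 1)} (hab : a ≤ b) (ha : a = 0) (hb : b = Fin.last k) (f : Fock n (E a)) :
    fockCast hb (segment Θ a b hab f) = product Θ (fockCast ha f) := by
  subst ha hb
  rfl

lemma norm_segment_le
    {Θ : ∀ i : Fin k, Fock n (E i.castSucc) →L[ℂ] Fock n (E i.succ)}
    (hΘ : ∀ i, IsContractiveMultiAnalytic (Θ i))
    (a b : Fin (k + 1)) (hab : a ≤ b) : ‖segment Θ a b hab‖ ≤ 1 :=
  (isContractiveMultiAnalytic_segment hΘ a b hab).contraction

variable [∀ i, CompleteSpace (E i)]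
  {Θ : ∀ i : Fin k, Fock n (E i.castSucc) →L[ℂ] Fock n (E i.succ)}

/-- The component with index `l` of the isometry `Z` associated with the factorization
`Θ_b ⋯ Θ_{a+1}`: the extension of `Δ f ↦ Δ_l (Θ_{l-1} ⋯ Θ_{a+1} f)`, where `Δ` is the defect
operator of the product. -/
def defectCoord (Θ : ∀ i : Fin k, Fock n (E i.castSucc) →L[ℂ] Fock n (E i.succ))
    {a b : Fin (k + 1)} (hab : a ≤ b) (l : Fin k) (hal : a ≤ l.castSucc) :
    defectSpace (segment Θ a b hab) →L[ℂ] defectSpace (Θ l) :=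
  defectLift (segment Θ a b hab) (toDefect (Θ l) ∘L segment Θ a l.castSucc hal)

lemma norm_toDefect_factor_le (hΘ : ∀ i, IsContractiveMultiAnalytic (Θ i)) {a b : Fin (k + 1)}
    (hab : a ≤ b) (l : Fin k) (hal : a ≤ l.castSucc) (hlb : l.succ ≤ b) (f : Fock n (E a)) :
    ‖toDefect (Θ l) (segment Θ a l.castSucc hal f)‖ ≤ ‖toDefect (segment Θ a b hab) f‖ := by
  refine norm_toDefect_middle_le (norm_segment_le hΘ _ _ _) (hΘ l).contraction
    (norm_segment_le hΘ _ _ hlb) (norm_segment_le hΘ _ _ _) (fun g => ?_) f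
  rw [segment_apply Θ a l.succ b (hal.trans l.castSucc_le_succ) hlb, segment_succ Θ a l hal]
  rfl

lemma norm_toDefect_segment_le (hΘ : ∀ i, IsContractiveMultiAnalytic (Θ i))
    {a b c d : Fin (k + 1)} (hac : a ≤ c) (hcd : c ≤ d) (hdb : d ≤ b) (f : Fock n (E a)) :
    ‖toDefect (segment Θ c d hcd) (segment Θ a c hac f)‖ ≤
      ‖toDefect (segment Θ a b (hac.trans (hcd.trans hdb))) f‖ := by
  refine norm_toDefect_middle_le (norm_segment_le hΘ _ _ _) (norm_segment_le hΘ _ _ _)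
    (norm_segment_le hΘ _ _ hdb) (norm_segment_le hΘ _ _ _) (fun g => ?_) f
  rw [segment_apply Θ a c b hac (hcd.trans hdb), segment_apply Θ c d b hcd hdb]

lemma defectCoord_toDefect (hΘ : ∀ i, IsContractiveMultiAnalytic (Θ i)) {a b : Fin (k + 1)}
    (hab : a ≤ b) (l : Fin k) (hal : a ≤ l.castSucc) (hlb : l.succ ≤ b) (f : Fock n (E a)) :
    defectCoord Θ hab l hal (toDefect (segment Θ a b hab) f) =
      toDefect (Θ l) (segment Θ a l.castSucc hal f) :=
  defectLift_toDefect (X := toDefect (Θ l) ∘L segment Θ a l.castSucc hal)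
    (norm_toDefect_factor_le hΘ hab l hal hlb) f

/-- The components for a group of consecutive factors are those for the whole product. -/
lemma defectCoord_defectLift (hΘ : ∀ i, IsContractiveMultiAnalytic (Θ i))
    {a b c d : Fin (k + 1)} (hac : a ≤ c) (hcd : c ≤ d) (hdb : d ≤ b) (l : Fin k)
    (hcl : c ≤ l.castSucc) (hld : l.succ ≤ d)
    (x : defectSpace (segment Θ a b (hac.trans (hcd.trans hdb)))) :
    defectCoord Θ hcd l hcl (defectLift (segment Θ a b (hac.trans (hcd.trans hdb)))
      (toDefect (segment Θ c d hcd) ∘L segment Θ a c hac) x) =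
      defectCoord Θ (hac.trans (hcd.trans hdb)) l (hac.trans hcl) x := by
  rw [defectCoord, defectLift_defectLift (norm_toDefect_segment_le hΘ hac hcd hdb)
    (norm_toDefect_factor_le hΘ hcd l hcl hld), defectCoord, comp_assoc,
    ← segment_comp Θ a c l.castSucc hac hcl]

/-- The components in the defect spaces of the factors determine a vector of the defect space of
the product. -/
lemma eq_zero_of_defectCoord_eq_zero (hΘ : ∀ i, IsContractiveMultiAnalytic (Θ i))
    (a b : Fin (k + 1)) (hab : a ≤ b) (x : defectSpace (segment Θ a b hab))
    (h : ∀ (l : Fin k) (hal : a ≤ l.castSucc), l.succ ≤ b → defectCoord Θ hab l hal x = 0) :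
    x = 0 := by
  have hid : ∀ c : Fin (k + 1), ∀ y : defectSpace (segment Θ c c le_rfl), y = 0 := by
    intro c
    rw [segment_self]
    exact eq_zero_of_mem_defectSpace_id
  induction b using Fin.induction with
  | zero =>
    obtain rfl : a = 0 := le_antisymm hab (Fin.zero_le _)
    exact hid _ x
  | succ b ih =>
    rcases eq_or_lt_of_le hab with rfl | hlt
    · exact hid _ x
    · have h' : a ≤ b.castSucc := Fin.le_castSucc_iff.2 hlt
      refine eq_zero_of_defectLift_eq_zero (norm_segment_le hΘ a b.castSucc h')
        (hΘ b).contraction (norm_segment_le hΘ _ _ _)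
        (fun f => by rw [segment_succ Θ a b h']; rfl) (ih h' _ fun l hal hlb => ?_)
        (h b h' le_rfl)
      have h1 := defectCoord_defectLift hΘ le_rfl h' b.castSucc_le_succ l hal hlb x
      rw [segment_self, comp_id] at h1
      rw [h1]
      exact h l hal (hlb.trans b.castSucc_le_succ)

lemma defectCoord_injective (hΘ : ∀ i, IsContractiveMultiAnalytic (Θ i))
    {a b : Fin (k + 1)} {hab : a ≤ b} {x y : defectSpace (segment Θ a b hab)}
    (h : ∀ (l : Fin k) (hal : a ≤ l.castSucc), l.succ ≤ b →
      defectCoord Θ hab l hal x = defectCoord Θ hab l hal y) : x = y :=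
  sub_eq_zero.1 <| eq_zero_of_defectCoord_eq_zero hΘ a b hab _ fun l hal hlb => by
    rw [map_sub, h l hal hlb, sub_self]

end Segment

/-! ### Regularity -/

section Regularity

variable {n k : ℕ} {E : Fin (k + 1) → Type*} [∀ i, NormedAddCommGroup (E i)]
  [∀ i, InnerProductSpace ℂ (E i)] [∀ i, CompleteSpace (E i)]
  {Θ : ∀ i : Fin k, Fock n (E i.castSucc) →L[ℂ] Fock n (E i.succ)}

lemma sum_castSucc_sub_succ {k : ℕ} (g : Fin (k + 1) → ℝ) :
    ∑ l : Fin k, (g l.castSucc - g l.succ) = g 0 - g (Fin.last k) := by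
  rw [Finset.sum_sub_distrib]
  linarith [Fin.sum_univ_castSucc g, Fin.sum_univ_succ g]

lemma norm_defectColumn (hΘ : ∀ i, IsContractiveMultiAnalytic (Θ i)) (f : Fock n (E 0)) :
    ‖defectColumn Θ f‖ = ‖toDefect (product Θ) f‖ := by
  rw [← sq_eq_sq₀ (norm_nonneg _) (norm_nonneg _), PiLp.norm_sq_eq_of_L2,
    norm_toDefect_sq (isContractiveMultiAnalytic_product hΘ).contraction]
  let g : Fin (k + 1) → ℝ := fun l => ‖segment Θ 0 l (Fin.zero_le _) f‖ ^ 2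
  have h0 : g 0 = ‖f‖ ^ 2 := by simp [g, segment_self]
  rw [← h0]
  refine Eq.trans (Finset.sum_congr rfl fun l _ => ?_) (sum_castSucc_sub_succ g)
  change ‖toDefect (Θ l) (segment Θ 0 l.castSucc (Fin.zero_le _) f)‖ ^ 2 = _
  rw [norm_toDefect_sq (hΘ l).contraction]
  simp only [g]
  rw [segment_succ Θ 0 l (Fin.zero_le _)]
  rfl

lemma regularityMap_toDefect (hΘ : ∀ i, IsContractiveMultiAnalytic (Θ i)) (f : Fock n (E 0)) :
    regularityMap Θ (toDefect (product Θ) f) = defectColumn Θ f :=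
  defectLift_toDefect (fun f => (norm_defectColumn hΘ f).le) f

lemma norm_regularityMap (hΘ : ∀ i, IsContractiveMultiAnalytic (Θ i))
    (d : defectSpace (product Θ)) : ‖regularityMap Θ d‖ = ‖d‖ := by
  induction d using defectSpace_induction with
  | hp => exact isClosed_eq (by fun_prop) (by fun_prop)
  | h f => rw [regularityMap_toDefect hΘ, norm_defectColumn hΘ]

lemma isometry_regularityMap (hΘ : ∀ i, IsContractiveMultiAnalytic (Θ i)) :
    Isometry (regularityMap Θ) :=
  AddMonoidHomClass.isometry_of_norm _ (norm_regularityMap hΘ)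

lemma regularityMap_apply (hΘ : ∀ i, IsContractiveMultiAnalytic (Θ i))
    (d : defectSpace (product Θ)) (l : Fin k) :
    regularityMap Θ d l = defectCoord Θ (Fin.zero_le _) l (Fin.zero_le _) d := by
  induction d using defectSpace_induction with
  | hp =>
    exact isClosed_eq (by fun_prop)
      (defectCoord Θ (Fin.zero_le (Fin.last k)) l (Fin.zero_le _)).continuous
  | h f =>
    rw [regularityMap_toDefect hΘ]
    exact (defectCoord_toDefect hΘ (Fin.zero_le _) l (Fin.zero_le _) (Fin.le_last _) f).symm

lemma adjoint_regularityMap_regularityMap (hΘ : ∀ i, IsContractiveMultiAnalytic (Θ i))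
    (d : defectSpace (product Θ)) : (regularityMap Θ).adjoint (regularityMap Θ d) = d :=
  DFunLike.congr_fun
    ((norm_map_iff_adjoint_comp_self (regularityMap Θ)).1 (norm_regularityMap hΘ)) d

/-- For a regular factorization, the subspace `M_i` depends only on the factorization
`Θ = (Θ_k ⋯ Θ_{i+1}) (Θ_i ⋯ Θ_1)` into two factors. -/
lemma invariantSubspace_eq_factorSubspace (hΘ : ∀ i, IsContractiveMultiAnalytic (Θ i))
    (hreg : IsRegularFactorization Θ) (i : Fin (k + 1)) :
    invariantSubspace Θ i = factorSubspace (product Θ) (segment Θ 0 i (Fin.zero_le _))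
      (segment Θ i (Fin.last k) (Fin.le_last _)) := by
  have hcoord := fun (l : Fin k) (hl : i ≤ l.castSucc) (d : defectSpace (product Θ)) =>
    (defectCoord_defectLift hΘ (Fin.zero_le i) (Fin.le_last i) le_rfl l hl (Fin.le_last _) d).trans
      (regularityMap_apply hΘ d l).symm
  ext x
  rw [mem_factorSubspace]
  constructor
  · rintro ⟨⟨f, v, hv, rfl⟩, hx⟩
    obtain ⟨d, rfl⟩ := hreg.2 v
    rw [adjoint_regularityMap_regularityMap hΘ] at hx ⊢
    refine ⟨⟨d.2, hx⟩, f, rfl, defectCoord_injective hΘ fun l hl hlb => ?_⟩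
    rw [defectCoord_toDefect hΘ _ l hl hlb, ← hv l hl]
    exact hcoord l hl d
  · rintro ⟨hx, f, hf, hd⟩
    refine ⟨⟨f, regularityMap Θ ⟨x.snd, hx.1⟩, fun l hl => ?_, ?_⟩, hx.2⟩
    · exact (hcoord l hl _).symm.trans ((congrArg _ hd).trans
        (defectCoord_toDefect hΘ _ l hl (Fin.le_last _) f))
    · rw [adjoint_regularityMap_regularityMap hΘ, ← hf]
      rfl

lemma isInvariantChain_of_isRegularFactorization (hΘ : ∀ i, IsContractiveMultiAnalytic (Θ i))
    (hreg : IsRegularFactorization Θ) : IsInvariantChain hΘ := by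
  have hseg := isContractiveMultiAnalytic_segment hΘ
  have hP := isContractiveMultiAnalytic_product hΘ
  refine ⟨fun i _ _ => ?_, fun i i' _ hi _ => ?_⟩
  · rw [invariantSubspace_eq_factorSubspace hΘ hreg]
    exact isJointInvariant_factorSubspace hP (hseg _ _ _) (hseg _ _ _)
      (segment_apply Θ 0 i (Fin.last k) (Fin.zero_le _) (Fin.le_last _))
  · rw [invariantSubspace_eq_factorSubspace hΘ hreg, invariantSubspace_eq_factorSubspace hΘ hreg]
    exact factorSubspace_mono hP.contraction (hseg _ _ _).contraction (hseg _ _ _).contraction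
      (hseg i i' hi).contraction (hseg _ _ _).contraction
      (segment_apply Θ 0 i (Fin.last k) (Fin.zero_le _) (Fin.le_last _))
      (segment_comp Θ 0 i i' (Fin.zero_le _) hi)
      (segment_apply Θ i i' (Fin.last k) hi (Fin.le_last _))

/-- Regularity in terms of components. The end points are variables, so that the statement applies
to indices that are only propositionally equal to `0` and to the last index. -/
lemma IsRegularFactorization.exists_defectCoord_eq (hreg : IsRegularFactorization Θ)
    (hΘ : ∀ i, IsContractiveMultiAnalytic (Θ i)) {a b : Fin (k + 1)} (hab : a ≤ b) (ha : a = 0)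
    (hb : b = Fin.last k) (v : ∀ l, defectSpace (Θ l)) :
    ∃ d : defectSpace (segment Θ a b hab), ∀ (l : Fin k) (hal : a ≤ l.castSucc),
      defectCoord Θ hab l hal d = v l := by
  subst ha hb
  obtain ⟨d, hd⟩ := hreg.2 (WithLp.toLp 2 v)
  refine ⟨d, fun l _ => (regularityMap_apply hΘ d l).symm.trans ?_⟩
  rw [hd]

lemma isRegularFactorization_aggregate {r : ℕ} (hΘ : ∀ i, IsContractiveMultiAnalytic (Θ i))
    (hreg : IsRegularFactorization Θ) (j : Fin (r + 1) → Fin (k + 1)) (hj : Monotone j)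
    (hj_zero : j 0 = 0) (hj_last : j (Fin.last r) = Fin.last k) :
    IsRegularFactorization (E := fun i => E (j i)) (aggregate Θ j hj) := by
  have hJ : ∀ i, IsContractiveMultiAnalytic (aggregate Θ j hj i) :=
    fun i => isContractiveMultiAnalytic_segment hΘ _ _ _
  refine ⟨isometry_regularityMap (E := fun i => E (j i)) hJ, fun u => ?_⟩
  -- Each `l` lies in at most one group, so the components of the `u m` in the defect spaces of the
  -- single factors form one family.
  have hv : ∀ l : Fin k, ∃ y : defectSpace (Θ l), ∀ (m : Fin r) (hml : j m.castSucc ≤ l.castSucc),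
      l.succ ≤ j m.succ → defectCoord Θ (hj m.castSucc_le_succ) l hml (u m) = y := by
    intro l
    by_cases hl : ∃ m : Fin r, j m.castSucc ≤ l.castSucc ∧ l.succ ≤ j m.succ
    · obtain ⟨m, hm1, hm2⟩ := hl
      refine ⟨defectCoord Θ (hj m.castSucc_le_succ) l hm1 (u m), fun m' hm1' hm2' => ?_⟩
      have key : ∀ p q : Fin r, j p.castSucc ≤ l.castSucc → l.succ ≤ j q.succ → ¬ q < p := by
        intro p q hp hq hqp
        have h1 : j q.succ ≤ j p.castSucc := hj (Fin.succ_le_castSucc_iff.2 hqp)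
        exact absurd ((hq.trans h1).trans hp) (not_le.2 l.castSucc_lt_succ)
      obtain rfl : m = m' := le_antisymm (not_lt.1 (key m m' hm1 hm2')) (not_lt.1 (key m' m hm1' hm2))
      rfl
    · exact ⟨0, fun m hm1 hm2 => absurd ⟨m, hm1, hm2⟩ hl⟩
  choose v hv using hv
  have hd : ∀ P, P = segment Θ (j 0) (j (Fin.last r)) (hj (Fin.zero_le _)) →
      ∃ d : defectSpace P, ∀ m : Fin r,
        defectLift P (toDefect (aggregate Θ j hj m) ∘L
          segment Θ (j 0) (j m.castSucc) (hj (Fin.zero_le _))) d = u m := by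
    rintro P rfl
    obtain ⟨d, hd⟩ := hreg.exists_defectCoord_eq hΘ (hj (Fin.zero_le (Fin.last r))) hj_zero hj_last v
    refine ⟨d, fun m => defectCoord_injective hΘ fun l hml hlm => ?_⟩
    rw [hv l m hml hlm, ← hd l ((hj (Fin.zero_le _)).trans hml)]
    exact defectCoord_defectLift hΘ (hj (Fin.zero_le _)) (hj m.castSucc_le_succ)
      (hj (Fin.le_last _)) l hml hlm d
  obtain ⟨d, hd⟩ := hd (product (E := fun i => E (j i)) (aggregate Θ j hj))
    (segment_aggregate Θ j hj _ _ _)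
  refine ⟨d, PiLp.ext fun m => ?_⟩
  refine (regularityMap_apply (E := fun i => E (j i)) hJ d m).trans (Eq.trans ?_ (hd m))
  exact congrArg (fun X => defectLift (product (E := fun i => E (j i)) (aggregate Θ j hj))
    (toDefect (aggregate Θ j hj m) ∘L X) d) (segment_aggregate Θ j hj 0 m.castSucc (Fin.zero_le _))

lemma map_ambientCast_factorSubspace {a b c a' b' : Fin (k + 1)} (ha : a = a') (hb : b = b')
    (hac : a ≤ c) (hcb : c ≤ b) :
    (factorSubspace (segment Θ a b (hac.trans hcb)) (segment Θ a c hac) (segment Θ c b hcb)).map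
      (ambientCast (n := n) (E := E) ha hb).toLinearEquiv.toLinearMap =
    factorSubspace (segment Θ a' b' (ha ▸ hb ▸ hac.trans hcb)) (segment Θ a' c (ha ▸ hac))
      (segment Θ c b' (hb ▸ hcb)) := by
  subst ha hb
  exact Submodule.map_id _

end Regularity
end FockModel

end

open FockModel
theorem mainTheorem6 {n k r : ℕ} (E : Fin (k + 1) → Type*) [∀ i, NormedAddCommGroup (E i)]
    [∀ i, InnerProductSpace ℂ (E i)] [∀ i, CompleteSpace (E i)]
    (Θ : ∀ i : Fin k, Fock n (E i.castSucc) →L[ℂ] Fock n (E i.succ))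
    (hΘ : ∀ i, IsContractiveMultiAnalytic (Θ i))
    (hreg : IsRegularFactorization Θ)
    (hpure : IsPurelyContractive (product Θ))
    (hszego : SatisfiesSzego (product Θ))
    (j : Fin (r + 1) → Fin (k + 1)) (hj : StrictMono j)
    (hj_zero : j 0 = 0) (hj_last : j (Fin.last r) = Fin.last k) :
    ∃ hJ : ∀ i, IsContractiveMultiAnalytic (aggregate Θ j hj.monotone i),
      (∀ f, fockCast hj_last (product (E := fun i => E (j i)) (aggregate Θ j hj.monotone) f) =
        product Θ (fockCast hj_zero f)) ∧
      IsRegularFactorization (E := fun i => E (j i)) (aggregate Θ j hj.monotone) ∧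
      IsInvariantChain hΘ ∧
      IsInvariantChain (E := fun i => E (j i)) hJ ∧
      ∀ i : Fin (r + 1), 0 < i → i < Fin.last r →
        (invariantSubspace (E := fun i => E (j i)) (aggregate Θ j hj.monotone) i).map
            (ambientCast (n := n) (E := E) hj_zero hj_last).toLinearEquiv.toLinearMap =
          invariantSubspace Θ (j i) := by
  have hJ : ∀ i, IsContractiveMultiAnalytic (aggregate Θ j hj.monotone i) :=
    fun i => isContractiveMultiAnalytic_segment hΘ _ _ _
  have hregJ := isRegularFactorization_aggregate hΘ hreg j hj.monotone hj_zero hj_last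
  have hprod : product (E := fun i => E (j i)) (aggregate Θ j hj.monotone) =
      segment Θ (j 0) (j (Fin.last r)) (hj.monotone (Fin.zero_le _)) :=
    segment_aggregate Θ j hj.monotone _ _ _
  refine ⟨hJ, fun f => ?_, hregJ, isInvariantChain_of_isRegularFactorization hΘ hreg,
    isInvariantChain_of_isRegularFactorization (E := fun i => E (j i)) hJ hregJ, fun i _ _ => ?_⟩
  · rw [hprod]
    exact fockCast_segment Θ _ hj_zero hj_last f
  · rw [invariantSubspace_eq_factorSubspace hΘ hreg,
      invariantSubspace_eq_factorSubspace (E := fun i => E (j i)) hJ hregJ, hprod,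
      segment_aggregate, segment_aggregate]
    exact map_ambientCast_factorSubspace hj_zero hj_last _ _
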